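/- Let $G$ be a finite two-player zero-sum extensive-form game with chance and perfect recall; player $1$ maximizes, player $2$ minimizes, and $u_i(\sigma_1,\sigma_2)$ denotes expected payoff. The histories are partitioned, for each player, into augmented information sets (the player's information sets where he acts; elsewhere classes of histories on which the sequence of his information sets and actions is the same) and into public states, which are closed under the augmented information sets of both players. A trunk is a non-empty set of histories closed under prefixes and public states; a subgame is a set of histories closed under extensions and public states. A subgame partitioning $\mathcal P$ is an increasing sequence of trunks $T_0\subseteq T_1\subseteq\dots\subseteq T_n$, with $T_n$ the set of all histories, such that for every public state at which some $T_k$ is left, the histories passing through that public state form a subgame. Put $S_0=T_0$ and $S_k=T_k\setminus T_{k-1}$, $\mathcal S=\{S_0,\dots,S_n\}$ (counted with $|\mathcal S|=n+1$), $\mathcal S'=\{S_0,\dots,S_{n-1}\}$; let $S^B$ be the set of histories outside $S$ that are reached from $S$ by one action, and $|I_{S^B}|$ the number of augmented information sets of player $1$ that meet $S^B$. A value function assigns to a public state $K$ and a pair of ranges (distributions of each player over his augmented information sets, given that $K$ is reached) a value for each augmented information set in $K$ of each player. It is optimal if for all ranges induced by a profile that reaches $K$ with positive probability, where $K$ is the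 root of a subgame, the values of the information sets of positive probability are the conditional expected payoffs under some Nash equilibrium of the subgame entered at $K$ with these ranges. For a trunk $T$, $u_1(\sigma)^T_V$ is the sum of $\pi^\sigma(z)u_1(z)$ over terminal $z\in T$ plus the sum, over the histories $h$ at which $T$ is left, of $\pi^\sigma(h)$ times the value returned by $V$ for the information set of player $1$ containing $h$, at the public state of $h$ and the ranges induced by $\sigma$. Let $\sigma_2^F$ be a fixed strategy of player $2$, $V$ an optimal value function, $\bar V$ a value function all of whose values differ from those of $V$ by at most $\epsilon_V$, and let $\sigma_1^{B}$ be a continual depth-limited best response to $\sigma_2^F$ computed with $\bar V$, $\mathcal P$ and regret at most $\epsilon_R$ in each step: for every $k=0,\dots,n$ and every strategy $\sigma_1'$ of player $1$ that agrees with $\sigma_1^B$ on $T_{k-1}$ (where $T_{-1}=\emptyset$), $$u_1(\sigma_1',\sigma_2^F)^{T_k}_{\bar V}\le u_1(\sigma_1^B,\sigma_2^F)^{T_k}_{\bar V}+\epsilon_R .$$ Then for every Nash equilibrium $\sigma^{NE}$ of $G$, $$u_1(\sigma_1^{B},\sigma_2^F)+|\mathcal S|\,\epsilon_R+\sum_{S\in\mathcal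 S'}|I_{S^B}|\,\epsilon_V\ \ge\ u_1(\sigma^{NE}).$$ -/

import Mathlib

/-- The two players: `one` is the maximizer and `two` is the minimizer. -/
inductive Player
  | one
  | two
  deriving DecidableEq

/-- A finite two-player extensive-form game with chance. Histories are finite sequences of actions.
`turn h = some i` means that player `i` acts at the non-terminal history `h`, `turn h = none` that
chance acts there. `info i h` is the name of the information set of player `i` that contains `h`,
so the information sets of `i` are the fibres of `info i` on the histories where `i` acts.
(`turn`, `chance`, `info`, `util` matter only on the histories where they are meaningful.) -/
structure EFG (A ι : Type*) [Fintype A] where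
  hist : Finset (List A)
  root_mem : [] ∈ hist
  hist_closed : ∀ h ∈ hist, ∀ g : List A, g <+: h → g ∈ hist
  turn : List A → Option Player
  chance : List A → A → ℝ
  chance_nonneg : ∀ h ∈ hist, turn h = none → ∀ a, h ++ [a] ∈ hist → 0 ≤ chance h a
  chance_sum : ∀ h ∈ hist, turn h = none → (∃ a, h ++ [a] ∈ hist) →
    (open Classical in ∑ a ∈ Finset.univ.filter (fun a => h ++ [a] ∈ hist), chance h a) = 1
  info : Player → List A → ι
  info_actions : ∀ i, ∀ h ∈ hist, ∀ h' ∈ hist,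
    (turn h = some i ∧ ∃ a, h ++ [a] ∈ hist) → (turn h' = some i ∧ ∃ a, h' ++ [a] ∈ hist) →
    info i h = info i h' → ∀ a, h ++ [a] ∈ hist ↔ h' ++ [a] ∈ hist
  util : Player → List A → ℝ

namespace EFG

variable {A ι μ κ : Type*} [Fintype A]

open Classical in
/-- The actions available at `h`. -/
noncomputable def actions (G : EFG A ι) (h : List A) : Finset A :=
  Finset.univ.filter (fun a => h ++ [a] ∈ G.hist)

open Classical in
/-- The terminal histories. -/
noncomputable def terminals (G : EFG A ι) : Finset (List A) :=
  G.hist.filter (fun h => ∀ a, h ++ [a] ∉ G.hist)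

/-- Player `i` acts at `h`. -/
def Acts (G : EFG A ι) (i : Player) (h : List A) : Prop :=
  h ∈ G.hist ∧ (∃ a, h ++ [a] ∈ G.hist) ∧ G.turn h = some i

/-- The utilities of the two players sum to zero at every terminal history. -/
def ZeroSum (G : EFG A ι) : Prop :=
  ∀ z ∈ G.terminals, G.util .one z + G.util .two z = 0

/-- The information sets and actions of player `i` met while the actions `w` are played from
`g` on. -/
def seqFrom (G : EFG A ι) (i : Player) : List A → List A → List (ι × A)
  | _, [] => []
  | g, a :: w =>
    if G.turn g = some i then (G.info i g, a) :: G.seqFrom i (g ++ [a]) w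
    else G.seqFrom i (g ++ [a]) w

/-- The sequence of information sets and actions of player `i` on the path to `h`. -/
def seq (G : EFG A ι) (i : Player) (h : List A) : List (ι × A) := G.seqFrom i [] h

/-- Perfect recall: in each information set a player remembers which information sets he has
visited and what he has played there. -/
def PerfectRecall (G : EFG A ι) : Prop :=
  ∀ i h h', G.Acts i h → G.Acts i h' → G.info i h = G.info i h' → G.seq i h = G.seq i h'

/-- A (behavioral) strategy of player `i`: a distribution over the available actions at each
history where `i` acts, the same for all histories of an information set. -/
structure Strategy (G : EFG A ι) (i : Player) where
  prob : List A → A → ℝ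
  nonneg : ∀ h, G.Acts i h → ∀ a ∈ G.actions h, 0 ≤ prob h a
  sum_eq_one : ∀ h, G.Acts i h → ∑ a ∈ G.actions h, prob h a = 1
  same : ∀ h h', G.Acts i h → G.Acts i h' → G.info i h = G.info i h' →
    ∀ a ∈ G.actions h, prob h a = prob h' a

/-- The probability that `a` is played at `h`. -/
def act (G : EFG A ι) (s : G.Strategy .one) (t : G.Strategy .two) (h : List A) (a : A) : ℝ :=
  match G.turn h with
  | some .one => s.prob h a
  | some .two => t.prob h a
  | none => G.chance h a

/-- The probability that the actions `w` are played from `g` on. -/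
def reachFrom (G : EFG A ι) (s : G.Strategy .one) (t : G.Strategy .two) :
    List A → List A → ℝ
  | _, [] => 1
  | g, a :: w => G.act s t g a * G.reachFrom s t (g ++ [a]) w

/-- The probability of reaching `h`. -/
def reach (G : EFG A ι) (s : G.Strategy .one) (t : G.Strategy .two) (h : List A) : ℝ :=
  G.reachFrom s t [] h

/-- The expected payoff of player `i`. -/
noncomputable def u (G : EFG A ι) (i : Player) (s : G.Strategy .one) (t : G.Strategy .two) : ℝ :=
  ∑ z ∈ G.terminals, G.reach s t z * G.util i z

/-- Nash equilibrium: each strategy is a best response to the other one. -/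
def IsNash (G : EFG A ι) (s : G.Strategy .one) (t : G.Strategy .two) : Prop :=
  (∀ s', G.u .one s' t ≤ G.u .one s t) ∧ (∀ t', G.u .two s t' ≤ G.u .two s t)

open Classical in
/-- The expected payoff of player `i` when play starts at `g`. -/
noncomputable def payoffFrom (G : EFG A ι) (i : Player) (s : G.Strategy .one)
    (t : G.Strategy .two) (g : List A) : ℝ :=
  ∑ z ∈ G.terminals.filter (fun z => g <+: z),
    G.reachFrom s t g (z.drop g.length) * G.util i z

/-- Augmented information sets of both players and public states, given by the names `aug i h`
and `pub h` of the classes that contain the history `h`. Where a player acts, his augmented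
information sets are his information sets. Elsewhere histories of one augmented information set
share the sequence of information sets and actions of that player; the coarsest choice identifies
all such histories, and finer ones also record what the player observes when he does not act.
Public states are closed under the augmented information sets of both players. -/
structure PublicStates (G : EFG A ι) (μ κ : Type*) where
  aug : Player → List A → μ
  pub : List A → κ
  aug_acts : ∀ i h, G.Acts i h → ∀ h' ∈ G.hist,
    (aug i h = aug i h' ↔ G.Acts i h' ∧ G.info i h = G.info i h')
  aug_seq : ∀ i, ∀ h ∈ G.hist, ∀ h' ∈ G.hist, ¬ G.Acts i h → ¬ G.Acts i h' →
    aug i h = aug i h' → G.seq i h = G.seq i h'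
  pub_closed : ∀ i, ∀ h ∈ G.hist, ∀ h' ∈ G.hist, aug i h = aug i h' → pub h = pub h'

namespace PublicStates

variable {G : EFG A ι}

/-- A trunk: a (non-empty) set of histories closed under prefixes and public states. -/
structure IsTrunk (O : G.PublicStates μ κ) (T : Finset (List A)) : Prop where
  sub : T ⊆ G.hist
  root : [] ∈ T
  down : ∀ h ∈ T, ∀ g : List A, g <+: h → g ∈ T
  pub : ∀ h ∈ T, ∀ h' ∈ G.hist, O.pub h = O.pub h' → h' ∈ T

/-- A subgame: a set of histories closed under extensions and public states. -/
structure IsSubgame (O : G.PublicStates μ κ) (S : Set (List A)) : Prop where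
  sub : ∀ h ∈ S, h ∈ G.hist
  up : ∀ g ∈ S, ∀ h ∈ G.hist, g <+: h → h ∈ S
  pub : ∀ h ∈ S, ∀ h' ∈ G.hist, O.pub h = O.pub h' → h' ∈ S

/-- All histories that pass through the public state `K`. -/
def below (O : G.PublicStates μ κ) (K : κ) : Set (List A) :=
  {h | h ∈ G.hist ∧ ∃ g, g <+: h ∧ O.pub g = K}

open Classical in
/-- The histories at which the public state `K` is entered: those of its members none of whose
proper prefixes lies in `K`. -/
noncomputable def entries (O : G.PublicStates μ κ) (K : κ) : Finset (List A) :=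
  G.hist.filter (fun h => O.pub h = K ∧ ∀ g : List A, g <+: h → O.pub g = K → g = h)

open Classical in
/-- The entry histories of `K` in the augmented information set `I` of player `i`. -/
noncomputable def entriesIn (O : G.PublicStates μ κ) (K : κ) (i : Player) (I : μ) :
    Finset (List A) :=
  (O.entries K).filter (fun h => O.aug i h = I)

/-- The probability of reaching the public state `K`. -/
noncomputable def reachPub (O : G.PublicStates μ κ) (s : G.Strategy .one) (t : G.Strategy .two)
    (K : κ) : ℝ :=
  ∑ g ∈ O.entries K, G.reach s t g

/-- The ranges of both players at the public state `K`: the distribution over the augmented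
information sets of player `i` given that `K` is reached. -/
noncomputable def range (O : G.PublicStates μ κ) (s : G.Strategy .one) (t : G.Strategy .two)
    (K : κ) (i : Player) (I : μ) : ℝ :=
  (∑ g ∈ O.entriesIn K i I, G.reach s t g) / O.reachPub s t K

/-- The payoff of player `i` in the subgame at `K` that starts with the distribution over the entry
histories of `K` induced by `(s, t)` and is continued by `(s', t')`. -/
noncomputable def subPayoff (O : G.PublicStates μ κ) (i : Player) (K : κ)
    (s : G.Strategy .one) (t : G.Strategy .two)
    (s' : G.Strategy .one) (t' : G.Strategy .two) : ℝ :=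
  ∑ g ∈ O.entries K, G.reach s t g / O.reachPub s t K * G.payoffFrom i s' t' g

/-- `(s', t')` is a Nash equilibrium of the subgame at `K` that is entered by playing `(s, t)`. -/
def IsSubNash (O : G.PublicStates μ κ) (K : κ) (s : G.Strategy .one) (t : G.Strategy .two)
    (s' : G.Strategy .one) (t' : G.Strategy .two) : Prop :=
  (∀ s'', O.subPayoff .one K s t s'' t' ≤ O.subPayoff .one K s t s' t') ∧
  (∀ t'', O.subPayoff .two K s t s' t'' ≤ O.subPayoff .two K s t s' t')

/-- The value, for player `i`, of his augmented information set `I` at the entry to `K`: his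
expected payoff given `I` when `K` is entered by `(s, t)` and play goes on by `(s', t')`. -/
noncomputable def infoValue (O : G.PublicStates μ κ) (K : κ)
    (s : G.Strategy .one) (t : G.Strategy .two) (s' : G.Strategy .one) (t' : G.Strategy .two)
    (i : Player) (I : μ) : ℝ :=
  (∑ g ∈ O.entriesIn K i I, G.reach s t g * G.payoffFrom i s' t' g) /
    ∑ g ∈ O.entriesIn K i I, G.reach s t g

/-- A value function takes a public state and the ranges of both players, and returns a value for
each augmented information set of each player. -/
abbrev ValueFunction (_O : G.PublicStates μ κ) : Type _ :=
  κ → (Player → μ → ℝ) → Player → μ → ℝ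

/-- An optimal value function returns the values of the information sets under some Nash
equilibrium of the subgame at the given public state, entered with the given ranges. (Ranges that
no play induces and information sets of probability zero are left unconstrained.) -/
def IsOptimal (O : G.PublicStates μ κ) (V : O.ValueFunction) : Prop :=
  ∀ K, O.IsSubgame (O.below K) → ∀ (s : G.Strategy .one) (t : G.Strategy .two),
    0 < O.reachPub s t K →
    ∃ (s' : G.Strategy .one) (t' : G.Strategy .two), O.IsSubNash K s t s' t' ∧
      ∀ i I, 0 < O.range s t K i I → V K (O.range s t K) i I = O.infoValue K s t s' t' i I

/-- All values returned by `W` and `V` for information sets of the given public state differ by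
at most `ε`. -/
def ErrorAtMost (O : G.PublicStates μ κ) (W V : O.ValueFunction) (ε : ℝ) : Prop :=
  ∀ K r i, ∀ g ∈ O.entries K, |W K r i (O.aug i g) - V K r i (O.aug i g)| ≤ ε

end PublicStates

open Classical in
/-- The border of a set of histories: the histories outside of it reached from it by one action. -/
noncomputable def border (G : EFG A ι) (S : Finset (List A)) : Finset (List A) :=
  G.hist.filter (fun h => h ∉ S ∧ ∃ g ∈ S, ∃ a, h = g ++ [a])

namespace PublicStates

variable {G : EFG A ι}

open Classical in
/-- The depth-limited utility of player one: payoffs of the terminal histories in the trunk `T`,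
and values of his information sets returned by `V`, for the ranges induced by `(s, t)`, where play
leaves `T`. -/
noncomputable def trunkUtil (O : G.PublicStates μ κ) (V : O.ValueFunction) (T : Finset (List A))
    (s : G.Strategy .one) (t : G.Strategy .two) : ℝ :=
  ∑ z ∈ G.terminals.filter (fun z => z ∈ T), G.reach s t z * G.util .one z +
  ∑ h ∈ G.border T,
    G.reach s t h * V (O.pub h) (O.range s t (O.pub h)) .one (O.aug .one h)

/-- A subgame partitioning, as the increasing sequence of trunks it creates: `trunk 0` is the
initial trunk, `trunk (k+1)` is `trunk k` joined with the next (depth-limited) subgame, and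
`trunk n` is the whole game. A subgame starts at each public state where a trunk is left. -/
structure SubgamePartitioning (O : G.PublicStates μ κ) where
  n : ℕ
  trunk : ℕ → Finset (List A)
  isTrunk : ∀ k, O.IsTrunk (trunk k)
  mono : Monotone trunk
  last : trunk n = G.hist
  isSubgame : ∀ k, ∀ h ∈ G.border (trunk k), O.IsSubgame (O.below (O.pub h))

namespace SubgamePartitioning

variable {O : G.PublicStates μ κ}

/-- What has been solved before step `k`: nothing before step `0`, else the previous trunk. -/
def prev (P : O.SubgamePartitioning) : ℕ → Finset (List A)
  | 0 => ∅
  | k + 1 => P.trunk k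

open Classical in
/-- The part of the game solved in step `k`: the initial trunk in step `0`, and the `k`-th
depth-limited subgame afterwards. -/
noncomputable def piece (P : O.SubgamePartitioning) (k : ℕ) : Finset (List A) :=
  P.trunk k \ P.prev k

open Classical in
/-- The (augmented) information sets of player one on the border of the part solved in
step `k`. -/
noncomputable def borderInfosets (P : O.SubgamePartitioning) (k : ℕ) : Finset μ :=
  (G.border (P.piece k)).image (O.aug .one)

/-- `s` is a continual depth-limited best response to `t`, with value function `V` and regret at
most `ε` in each step: in step `k`, with the strategy in the previous trunk fixed, no strategy has
a depth-limited utility in the trunk `k` that exceeds that of `s` by more than `ε`. -/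
def IsCDBR (P : O.SubgamePartitioning) (t : G.Strategy .two) (V : O.ValueFunction) (ε : ℝ)
    (s : G.Strategy .one) : Prop :=
  ∀ k ≤ P.n, ∀ s' : G.Strategy .one,
    (∀ h ∈ P.prev k, G.Acts .one h → ∀ a ∈ G.actions h, s'.prob h a = s.prob h a) →
    O.trunkUtil V (P.trunk k) s' t ≤ O.trunkUtil V (P.trunk k) s t + ε

end SubgamePartitioning

end PublicStates

end EFG

/-! Value functions give bounds in both directions because the values returned by an optimal `V`
come from saddle points of the subgames at the exits of a trunk `T`. Replacing player two's play
below `T` by his equilibrium strategies holds any `s` down to `trunkUtil V T s t`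
(`exists_u_le_trunkUtil`). Replacing player one's play below `T` secures that amount against every
opponent who agrees with `t` on `T` (`exists_trunkUtil_le_u`).

`IsCDBR.u_le_trunkUtil` climbs the trunks with these two bounds. In the initial trunk, the
equilibrium strategy of player one competes with `σ`; player two's deviation below the trunk cannot
push it under the equilibrium payoff. In trunk `k + 1` the competitor follows `σ` in trunk `k` and
the securing strategies afterwards, so its depth-limited utility is at least that of `σ` in trunk
`k`. Each step costs `εR` and an evaluation error; the last trunk has no border, so there the
depth-limited utility is the true payoff.

The evaluation error compares two strategies, and a crude estimate is `2 * ε` whatever the border.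
Errors on the old border cancel, as both strategies induce the same ranges there. On the new border,
two or more information sets already pay for `2 * ε`. For a single one, perfect recall makes player
one's own reach a common factor of all its histories; it cancels from the ranges, both strategies
see the same error, and `ε` suffices. -/

namespace EFG

variable {A ι μ κ : Type*} [Fintype A] {G : EFG A ι}

/-! ### Play and reach probabilities -/

theorem mem_actions {h : List A} {a : A} : a ∈ G.actions h ↔ h ++ [a] ∈ G.hist := by
  simp [actions]

theorem act_nonneg (s : G.Strategy .one) (t : G.Strategy .two) {h : List A} {a : A}
    (ha : h ++ [a] ∈ G.hist) : 0 ≤ G.act s t h a := by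
  have hh : h ∈ G.hist := G.hist_closed _ ha _ (List.prefix_append _ _)
  unfold act
  split
  · next e => exact s.nonneg h ⟨hh, ⟨a, ha⟩, e⟩ a (mem_actions.2 ha)
  · next e => exact t.nonneg h ⟨hh, ⟨a, ha⟩, e⟩ a (mem_actions.2 ha)
  · next e => exact G.chance_nonneg h hh e a ha

theorem sum_act (s : G.Strategy .one) (t : G.Strategy .two) {h : List A}
    (hex : ∃ a, h ++ [a] ∈ G.hist) : ∑ a ∈ G.actions h, G.act s t h a = 1 := by
  have hh : h ∈ G.hist := G.hist_closed _ hex.choose_spec _ (List.prefix_append _ _)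
  unfold act
  split
  · next e => exact s.sum_eq_one h ⟨hh, hex, e⟩
  · next e => exact t.sum_eq_one h ⟨hh, hex, e⟩
  · next e => exact G.chance_sum h hh e hex

theorem act_congr {s s' : G.Strategy .one} {t t' : G.Strategy .two} {h : List A} {a : A}
    (ha : h ++ [a] ∈ G.hist) (h₁ : G.Acts .one h → s.prob h a = s'.prob h a)
    (h₂ : G.Acts .two h → t.prob h a = t'.prob h a) : G.act s t h a = G.act s' t' h a := by
  have hh : h ∈ G.hist := G.hist_closed _ ha _ (List.prefix_append _ _)
  unfold act
  split
  · next e => exact h₁ ⟨hh, ⟨a, ha⟩, e⟩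
  · next e => exact h₂ ⟨hh, ⟨a, ha⟩, e⟩
  · rfl

theorem reachFrom_nonneg (s : G.Strategy .one) (t : G.Strategy .two) :
    ∀ w g : List A, g ++ w ∈ G.hist → 0 ≤ G.reachFrom s t g w
  | [], _, _ => by simp [reachFrom]
  | a :: w, g, h => by
    have e : g ++ a :: w = (g ++ [a]) ++ w := by simp
    rw [e] at h
    exact mul_nonneg (act_nonneg s t (G.hist_closed _ h _ (List.prefix_append _ _)))
      (reachFrom_nonneg s t w _ h)

theorem reach_nonneg (s : G.Strategy .one) (t : G.Strategy .two) {h : List A}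
    (hh : h ∈ G.hist) : 0 ≤ G.reach s t h :=
  reachFrom_nonneg s t h [] hh

theorem reachFrom_append (s : G.Strategy .one) (t : G.Strategy .two) :
    ∀ v g w : List A,
      G.reachFrom s t g (v ++ w) = G.reachFrom s t g v * G.reachFrom s t (g ++ v) w
  | [], g, w => by simp [reachFrom]
  | a :: v, g, w => by
    simp [reachFrom, reachFrom_append s t v, mul_assoc]

theorem reach_eq_mul (s : G.Strategy .one) (t : G.Strategy .two) {g z : List A}
    (h : g <+: z) : G.reach s t z = G.reach s t g * G.reachFrom s t g (z.drop g.length) := by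
  obtain ⟨w, rfl⟩ := h
  simp [reach, reachFrom_append]

theorem reachFrom_congr {s s' : G.Strategy .one} {t t' : G.Strategy .two} :
    ∀ w g : List A,
      (∀ x a, g <+: x → x ++ [a] <+: g ++ w → G.act s t x a = G.act s' t' x a) →
      G.reachFrom s t g w = G.reachFrom s' t' g w
  | [], _, _ => rfl
  | a :: w, g, h => by
    simp only [reachFrom]
    rw [h g a (List.prefix_refl _) (by simp), reachFrom_congr w (g ++ [a])]
    intro x b hx hb
    exact h x b ((List.prefix_append _ _).trans hx) (by simpa using hb)

theorem payoffFrom_congr {s s' : G.Strategy .one} {t t' : G.Strategy .two} {i : Player}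
    {g : List A}
    (h : ∀ x a, g <+: x → x ++ [a] ∈ G.hist → G.act s t x a = G.act s' t' x a) :
    G.payoffFrom i s t g = G.payoffFrom i s' t' g := by
  classical
  unfold payoffFrom
  refine Finset.sum_congr rfl fun z hz => ?_
  rw [Finset.mem_filter] at hz
  obtain ⟨hz, w, rfl⟩ := hz
  congr 1
  refine reachFrom_congr _ _ fun x a hx ha => h x a hx ?_
  exact G.hist_closed _ (Finset.mem_filter.1 hz).1 _ (by simpa using ha)

-- Members of an antichain are mutually exclusive events. The induction is on `N`, a bound on the
-- remaining depth below `g`.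
open Classical in
theorem sum_reachFrom_le_one (s : G.Strategy .one) (t : G.Strategy .two) (B : Finset (List A))
    (hB : B ⊆ G.hist) (anti : ∀ g ∈ B, ∀ h ∈ B, g <+: h → g = h) :
    ∀ (N : ℕ) (g : List A), (∀ h ∈ G.hist, h.length ≤ g.length + N) →
      ∑ h ∈ B.filter (fun h => g <+: h), G.reachFrom s t g (h.drop g.length) ≤ 1 := by
  intro N
  induction N with
  | zero =>
    intro g hN
    have hsub : B.filter (fun h => g <+: h) ⊆ {g} := by
      intro h hh
      rw [Finset.mem_filter] at hh
      exact Finset.mem_singleton.2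
        (hh.2.eq_of_length_le (by simpa using hN h (hB hh.1))).symm
    rcases Finset.subset_singleton_iff.1 hsub with e | e <;> rw [e] <;> simp [reachFrom]
  | succ N ih =>
    intro g hN
    by_cases hg : g ∈ B
    · have e : B.filter (fun h => g <+: h) = {g} := by
        ext h
        simp only [Finset.mem_filter, Finset.mem_singleton]
        constructor
        · exact fun hh => (anti g hg h hh.1 hh.2).symm
        · rintro rfl
          exact ⟨hg, List.prefix_refl _⟩
      rw [e]
      simp [reachFrom]
    -- As `g` itself is not in `B`, every member below `g` passes through exactly one child of `g`.
    have e : B.filter (fun h => g <+: h) =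
        (G.actions g).biUnion (fun a => B.filter (fun h => g ++ [a] <+: h)) := by
      ext h
      simp only [Finset.mem_filter, Finset.mem_biUnion, mem_actions]
      constructor
      · rintro ⟨hb, w, rfl⟩
        cases w with
        | nil => exact absurd (by simpa using hb) hg
        | cons a w =>
          have hp : g ++ [a] <+: g ++ a :: w := by simp
          exact ⟨a, G.hist_closed _ (hB hb) _ hp, hb, hp⟩
      · rintro ⟨a, -, hb, hp⟩
        exact ⟨hb, (List.prefix_append _ _).trans hp⟩
    have hdisj : ∀ a ∈ G.actions g, ∀ b ∈ G.actions g, a ≠ b →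
        Disjoint (B.filter (fun h => g ++ [a] <+: h)) (B.filter (fun h => g ++ [b] <+: h)) := by
      intro a _ b _ hab
      rw [Finset.disjoint_left]
      intro h h₁ h₂
      rw [Finset.mem_filter] at h₁ h₂
      apply hab
      have := List.prefix_of_prefix_length_le h₁.2 h₂.2 (by simp)
      simpa using this.eq_of_length (by simp)
    rw [e, Finset.sum_biUnion hdisj]
    have hstep : ∀ a ∈ G.actions g, ∑ h ∈ B.filter (fun h => g ++ [a] <+: h),
        G.reachFrom s t g (h.drop g.length) ≤ G.act s t g a := by
      intro a ha
      have : ∑ h ∈ B.filter (fun h => g ++ [a] <+: h), G.reachFrom s t g (h.drop g.length) =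
          G.act s t g a * ∑ h ∈ B.filter (fun h => g ++ [a] <+: h),
            G.reachFrom s t (g ++ [a]) (h.drop (g ++ [a]).length) := by
        rw [Finset.mul_sum]
        refine Finset.sum_congr rfl fun h hh => ?_
        obtain ⟨w, rfl⟩ := (Finset.mem_filter.1 hh).2
        rw [List.drop_left, List.append_assoc, List.drop_left]
        rfl
      rw [this]
      refine mul_le_of_le_one_right (act_nonneg s t (mem_actions.1 ha)) (ih _ fun h hh => ?_)
      have := hN h hh
      simp only [List.length_append, List.length_singleton]
      omega
    refine (Finset.sum_le_sum hstep).trans ?_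
    by_cases hex : ∃ a, g ++ [a] ∈ G.hist
    · exact (sum_act s t hex).le
    · have : G.actions g = ∅ := by
        ext a
        simpa [mem_actions] using fun ha => hex ⟨a, ha⟩
      simp [this]

theorem sum_reach_le_one (s : G.Strategy .one) (t : G.Strategy .two) {B : Finset (List A)}
    (hB : B ⊆ G.hist) (anti : ∀ g ∈ B, ∀ h ∈ B, g <+: h → g = h) :
    ∑ h ∈ B, G.reach s t h ≤ 1 := by
  classical
  have := sum_reachFrom_le_one s t B hB anti (G.hist.sup List.length) []
    (fun h hh => by simpa using Finset.le_sup (f := List.length) hh)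
  simpa [reach] using this

/-! ### Agreement of strategies, trunks and their borders -/

/-- Two strategies prescribe the same behavior in `T`. -/
def Strategy.AgreeOn {i : Player} (T : Finset (List A)) (s s' : G.Strategy i) : Prop :=
  ∀ h ∈ T, G.Acts i h → ∀ a ∈ G.actions h, s.prob h a = s'.prob h a

theorem Strategy.AgreeOn.refl {i : Player} (T : Finset (List A)) (s : G.Strategy i) :
    s.AgreeOn T s := fun _ _ _ _ _ => rfl

theorem reach_congr {s s' : G.Strategy .one} {t t' : G.Strategy .two} {T : Finset (List A)}
    (h₁ : s.AgreeOn T s') (h₂ : t.AgreeOn T t') {h : List A} (hh : h ∈ G.hist)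
    (hT : ∀ x, x <+: h → x ≠ h → x ∈ T) : G.reach s t h = G.reach s' t' h := by
  refine reachFrom_congr _ _ fun x a _ ha => ?_
  rw [List.nil_append] at ha
  have hx : x ∈ T := by
    refine hT x ((List.prefix_append _ _).trans ha) ?_
    rintro rfl
    simpa using ha.length_le
  have ha' := G.hist_closed _ hh _ ha
  exact act_congr ha' (fun hA => h₁ x hx hA a (mem_actions.2 ha'))
    (fun hA => h₂ x hx hA a (mem_actions.2 ha'))

theorem mem_border {S : Finset (List A)} {h : List A} :
    h ∈ G.border S ↔ h ∈ G.hist ∧ h ∉ S ∧ ∃ g ∈ S, ∃ a, h = g ++ [a] := by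
  simp [border]

theorem border_hist : G.border G.hist = ∅ := by
  ext h
  simp only [mem_border, Finset.notMem_empty, iff_false]
  exact fun hh => hh.2.1 hh.1

namespace PublicStates

variable {O : G.PublicStates μ κ} {T : Finset (List A)}

namespace IsTrunk

theorem mem_of_prefix_border (hT : O.IsTrunk T) {g x : List A} (hg : g ∈ G.border T)
    (hx : x <+: g) (hne : x ≠ g) : x ∈ T := by
  obtain ⟨-, -, p, hp, a, rfl⟩ := mem_border.1 hg
  rcases List.prefix_concat_iff.1 hx with h | h
  · exact absurd h (by simpa using hne)
  · exact hT.down p hp x h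

theorem border_antichain (hT : O.IsTrunk T) :
    ∀ g ∈ G.border T, ∀ h ∈ G.border T, g <+: h → g = h := by
  intro g hg h hh hgh
  by_contra hne
  exact (mem_border.1 hg).2.1 (hT.mem_of_prefix_border hh hgh hne)

theorem border_unique (hT : O.IsTrunk T) {g g' h : List A} (hg : g ∈ G.border T)
    (hg' : g' ∈ G.border T) (h₁ : g <+: h) (h₂ : g' <+: h) : g = g' := by
  rcases List.prefix_or_prefix_of_prefix h₁ h₂ with h | h
  · exact hT.border_antichain g hg g' hg' h
  · exact (hT.border_antichain g' hg' g hg h).symm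

theorem exists_border_prefix (hT : O.IsTrunk T) {h : List A} (hh : h ∈ G.hist) (hn : h ∉ T) :
    ∃ g ∈ G.border T, g <+: h := by
  induction h using List.reverseRecOn with
  | nil => exact absurd hT.root hn
  | append_singleton h a ih =>
    by_cases hm : h ∈ T
    · exact ⟨_, mem_border.2 ⟨hh, hn, h, hm, a, rfl⟩, List.prefix_refl _⟩
    · obtain ⟨g, hg, hp⟩ := ih (G.hist_closed _ hh _ (List.prefix_append _ _)) hm
      exact ⟨g, hg, hp.trans (List.prefix_append _ _)⟩

theorem reach_congr_border (hT : O.IsTrunk T) {s s' : G.Strategy .one} {t t' : G.Strategy .two}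
    (h₁ : s.AgreeOn T s') (h₂ : t.AgreeOn T t') {h : List A} (hh : h ∈ G.border T) :
    G.reach s t h = G.reach s' t' h :=
  reach_congr h₁ h₂ (mem_border.1 hh).1 fun _ hx hne => hT.mem_of_prefix_border hh hx hne

theorem reach_congr_mem (hT : O.IsTrunk T) {s s' : G.Strategy .one} {t t' : G.Strategy .two}
    (h₁ : s.AgreeOn T s') (h₂ : t.AgreeOn T t') {h : List A} (hh : h ∈ T) :
    G.reach s t h = G.reach s' t' h :=
  reach_congr h₁ h₂ (hT.sub hh) fun x hx _ => hT.down h hh x hx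

-- A terminal history outside `T` extends exactly one border history, at which its reach probability
-- factors.
open Classical in
theorem u_eq_add (hT : O.IsTrunk T) (i : Player) (s : G.Strategy .one) (t : G.Strategy .two) :
    G.u i s t = ∑ z ∈ G.terminals.filter (fun z => z ∈ T), G.reach s t z * G.util i z +
      ∑ h ∈ G.border T, G.reach s t h * G.payoffFrom i s t h := by
  unfold u
  rw [← Finset.sum_filter_add_sum_filter_not G.terminals (fun z => z ∈ T)]
  congr 1
  have e : G.terminals.filter (fun z => z ∉ T) =
      (G.border T).biUnion (fun g => G.terminals.filter (fun z => g <+: z)) := by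
    ext z
    simp only [Finset.mem_filter, Finset.mem_biUnion]
    constructor
    · rintro ⟨hz, hn⟩
      obtain ⟨g, hg, hp⟩ := hT.exists_border_prefix (Finset.mem_filter.1 hz).1 hn
      exact ⟨g, hg, hz, hp⟩
    · rintro ⟨g, hg, hz, hp⟩
      exact ⟨hz, fun hm => (mem_border.1 hg).2.1 (hT.down z hm g hp)⟩
  rw [e, Finset.sum_biUnion]
  · refine Finset.sum_congr rfl fun g _ => ?_
    unfold payoffFrom
    rw [Finset.mul_sum]
    refine Finset.sum_congr rfl fun z hz => ?_
    rw [reach_eq_mul s t (Finset.mem_filter.1 hz).2, mul_assoc]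
  · intro g hg g' hg' hne
    rw [Function.onFun, Finset.disjoint_left]
    intro z h₁ h₂
    exact hne (hT.border_unique hg hg' (Finset.mem_filter.1 h₁).2 (Finset.mem_filter.1 h₂).2)

end IsTrunk

/-! ### Exits into subgames and gluing of strategies -/

/-- A subgame starts at every public state at which the trunk `T` is left. -/
def LeavesIntoSubgames (O : G.PublicStates μ κ) (T : Finset (List A)) : Prop :=
  ∀ h ∈ G.border T, O.IsSubgame (O.below (O.pub h))

theorem mem_entries {K : κ} {h : List A} :
    h ∈ O.entries K ↔
      h ∈ G.hist ∧ O.pub h = K ∧ ∀ g : List A, g <+: h → O.pub g = K → g = h := by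
  simp [entries]

namespace IsTrunk

theorem eq_of_prefix_border (hT : O.IsTrunk T) {e g x : List A} (he : e ∈ G.border T)
    (hg : g ∈ G.border T) (hx : x <+: g) (hpub : O.pub x = O.pub e) : x = g := by
  by_contra hne
  obtain ⟨he₁, he₂, -⟩ := mem_border.1 he
  exact he₂ (hT.pub x (hT.mem_of_prefix_border hg hx hne) e he₁ hpub)

/-- The public state at which play left a trunk can be read off every later public state that is
itself entered on the border. -/
theorem pub_eq_of_prefix (hT : O.IsTrunk T) (hS : O.LeavesIntoSubgames T) {e g x : List A}
    (he : e ∈ G.border T) (hg : g ∈ G.border T) (hx : x ∈ G.hist) (hex : e <+: x)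
    (hpub : O.pub x = O.pub g) : O.pub e = O.pub g := by
  have hx' : x ∈ O.below (O.pub e) := ⟨hx, e, hex, rfl⟩
  -- Closure of the subgame under public states puts `g` into it. The witnessing prefix of `g`
  -- cannot lie in `T`, since `T` would then contain `e`; so it is `g` itself.
  obtain ⟨-, y, hy, hye⟩ := (hS e he).pub x hx' g (mem_border.1 hg).1 hpub
  rw [← hT.eq_of_prefix_border he hg hy hye, hye]

/-- A public state at which `T` is left is entered only on the border of `T`. Hence the border
splits into full entry sets, and the ranges there depend only on play in `T`. -/
theorem mem_entries_iff (hT : O.IsTrunk T) (hS : O.LeavesIntoSubgames T) {g h : List A}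
    (hg : g ∈ G.border T) : h ∈ O.entries (O.pub g) ↔ h ∈ G.border T ∧ O.pub h = O.pub g := by
  rw [mem_entries]
  constructor
  · rintro ⟨hh, hpub, hmin⟩
    obtain ⟨hg₁, hg₂, -⟩ := mem_border.1 hg
    obtain ⟨e, he, heh⟩ := hT.exists_border_prefix hh
      (fun hm => hg₂ (hT.pub h hm g hg₁ hpub))
    have := hmin e heh (hT.pub_eq_of_prefix hS he hg hh heh hpub)
    exact ⟨this ▸ he, hpub⟩
  · rintro ⟨hh, hpub⟩
    exact ⟨(mem_border.1 hh).1, hpub, fun x hx hxp => hT.eq_of_prefix_border hg hh hx hxp⟩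

open Classical in
theorem sum_border (hT : O.IsTrunk T) (hS : O.LeavesIntoSubgames T) (f : List A → ℝ) :
    ∑ h ∈ G.border T, f h =
      ∑ K ∈ (G.border T).image O.pub, ∑ h ∈ O.entries K, f h := by
  rw [← Finset.sum_fiberwise_of_maps_to (g := O.pub) (t := (G.border T).image O.pub)
    (fun h hh => Finset.mem_image_of_mem _ hh)]
  refine Finset.sum_congr rfl fun K hK => ?_
  obtain ⟨g, hg, rfl⟩ := Finset.mem_image.1 hK
  refine Finset.sum_congr ?_ fun _ _ => rfl
  ext h
  rw [Finset.mem_filter, hT.mem_entries_iff hS hg]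

end IsTrunk

open Classical in
/-- The public state at which play leaves the trunk `T` on the way to `h`. -/
noncomputable def exitPub (O : G.PublicStates μ κ) (T : Finset (List A)) (h : List A) : κ :=
  -- The fallback is never relevant: gluing consults this only outside `T`, where a border prefix
  -- exists.
  if hex : ∃ g ∈ G.border T, g <+: h then O.pub hex.choose else O.pub h

theorem IsTrunk.exitPub_eq (hT : O.IsTrunk T) {g h : List A} (hg : g ∈ G.border T)
    (hgh : g <+: h) : O.exitPub T h = O.pub g := by
  have hex : ∃ g ∈ G.border T, g <+: h := ⟨g, hg, hgh⟩
  rw [exitPub, dif_pos hex]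
  rw [hT.border_unique hex.choose_spec.1 hg hex.choose_spec.2 hgh]

theorem pub_eq_of_info (O : G.PublicStates μ κ) {i : Player} {h h' : List A} (hh : G.Acts i h)
    (hh' : G.Acts i h') (hinfo : G.info i h = G.info i h') : O.pub h = O.pub h' :=
  O.pub_closed i h hh.1 h' hh'.1 ((O.aug_acts i h hh h' hh'.1).2 ⟨hh', hinfo⟩)

/-- This is what makes a glued strategy legal: an information set lies in one public state, so all
its histories must have left `T` at the same place. -/
theorem IsTrunk.exitPub_congr (hT : O.IsTrunk T) (hS : O.LeavesIntoSubgames T) {h h' : List A}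
    (hh : h ∈ G.hist) (hh' : h' ∈ G.hist) (hn : h ∉ T) (hpub : O.pub h = O.pub h') :
    O.exitPub T h = O.exitPub T h' := by
  have hn' : h' ∉ T := fun hm => hn (hT.pub h' hm h hh hpub.symm)
  obtain ⟨e, he, heh⟩ := hT.exists_border_prefix hh hn
  obtain ⟨e', he', heh'⟩ := hT.exists_border_prefix hh' hn'
  rw [hT.exitPub_eq he heh, hT.exitPub_eq he' heh']
  -- The subgame entered at `e` contains `h'`, so `h'` also passes through the public state of `e`,
  -- at `y`. Since `y` is outside `T`, it lies below the exit `e'` of `h'`.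
  obtain ⟨-, y, hy, hye⟩ := (hS e he).pub h ⟨hh, e, heh, rfl⟩ h' hh' hpub
  have hyh : y ∈ G.hist := G.hist_closed _ hh' _ hy
  have hyT : y ∉ T := fun hm => (mem_border.1 he).2.1 (hT.pub y hm e (mem_border.1 he).1 hye)
  obtain ⟨x, hx, hxy⟩ := hT.exists_border_prefix hyh hyT
  have hxe := hT.border_unique hx he' (hxy.trans hy) heh'
  subst hxe
  exact (hT.pub_eq_of_prefix hS hx he hyh hxy hye).symm

open Classical in
/-- Follow `s` in the trunk `T` and `τ K` once `T` has been left at the public state `K`. -/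
noncomputable def IsTrunk.glue (hT : O.IsTrunk T) (hS : O.LeavesIntoSubgames T) {i : Player}
    (s : G.Strategy i) (τ : κ → G.Strategy i) : G.Strategy i where
  prob h := if h ∈ T then s.prob h else (τ (O.exitPub T h)).prob h
  nonneg h hA a ha := by
    split_ifs
    · exact s.nonneg h hA a ha
    · exact (τ _).nonneg h hA a ha
  sum_eq_one h hA := by
    split_ifs
    · exact s.sum_eq_one h hA
    · exact (τ _).sum_eq_one h hA
  same h h' hA hA' hinfo a ha := by
    have hpub := O.pub_eq_of_info hA hA' hinfo
    by_cases hm : h ∈ T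
    · rw [if_pos hm, if_pos (hT.pub h hm h' hA'.1 hpub)]
      exact s.same h h' hA hA' hinfo a ha
    · have hm' : h' ∉ T := fun hx => hm (hT.pub h' hx h hA.1 hpub.symm)
      rw [if_neg hm, if_neg hm', hT.exitPub_congr hS hA.1 hA'.1 hm hpub]
      exact (τ _).same h h' hA hA' hinfo a ha

namespace IsTrunk

theorem agreeOn_glue (hT : O.IsTrunk T) (hS : O.LeavesIntoSubgames T) {i : Player}
    (s : G.Strategy i) (τ : κ → G.Strategy i) : s.AgreeOn T (hT.glue hS s τ) := by
  intro h hh _ a _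
  simp [glue, hh]

theorem glue_prob_of_prefix (hT : O.IsTrunk T) (hS : O.LeavesIntoSubgames T) {i : Player}
    (s : G.Strategy i) (τ : κ → G.Strategy i) {g x : List A} (hg : g ∈ G.border T)
    (hgx : g <+: x) : (hT.glue hS s τ).prob x = (τ (O.pub g)).prob x := by
  have hx : x ∉ T := fun hm => (mem_border.1 hg).2.1 (hT.down x hm g hgx)
  simp [glue, hx, hT.exitPub_eq hg hgx]

theorem payoffFrom_glue_left (hT : O.IsTrunk T) (hS : O.LeavesIntoSubgames T) (i : Player)
    (s : G.Strategy .one) (τ : κ → G.Strategy .one) (t : G.Strategy .two) {g : List A}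
    (hg : g ∈ G.border T) :
    G.payoffFrom i (hT.glue hS s τ) t g = G.payoffFrom i (τ (O.pub g)) t g :=
  payoffFrom_congr fun _ _ hx ha =>
    act_congr ha (fun _ => by rw [hT.glue_prob_of_prefix hS s τ hg hx]) (fun _ => rfl)

theorem payoffFrom_glue_right (hT : O.IsTrunk T) (hS : O.LeavesIntoSubgames T) (i : Player)
    (s : G.Strategy .one) (t : G.Strategy .two) (τ : κ → G.Strategy .two) {g : List A}
    (hg : g ∈ G.border T) :
    G.payoffFrom i s (hT.glue hS t τ) g = G.payoffFrom i s (τ (O.pub g)) g :=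
  payoffFrom_congr fun _ _ hx ha =>
    act_congr ha (fun _ => rfl) (fun _ => by rw [hT.glue_prob_of_prefix hS t τ hg hx])

end IsTrunk

end PublicStates

/-! ### Optimal values as saddle points -/

theorem payoffFrom_two (hzero : G.ZeroSum) (s : G.Strategy .one) (t : G.Strategy .two)
    (g : List A) : G.payoffFrom .two s t g = -G.payoffFrom .one s t g := by
  classical
  unfold payoffFrom
  rw [← Finset.sum_neg_distrib]
  refine Finset.sum_congr rfl fun z hz => ?_
  have := hzero z (Finset.mem_filter.1 hz).1
  rw [show G.util .two z = -G.util .one z by linarith, mul_neg]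

theorem u_two (hzero : G.ZeroSum) (s : G.Strategy .one) (t : G.Strategy .two) :
    G.u .two s t = -G.u .one s t := by
  unfold u
  rw [← Finset.sum_neg_distrib]
  refine Finset.sum_congr rfl fun z hz => ?_
  have := hzero z hz
  rw [show G.util .two z = -G.util .one z by linarith, mul_neg]

namespace PublicStates

variable {O : G.PublicStates μ κ} {T : Finset (List A)} {V W : O.ValueFunction}

theorem entries_subset (K : κ) : O.entries K ⊆ G.hist :=
  fun _ h => (mem_entries.1 h).1

theorem reachPub_mul_subPayoff {K : κ} {s : G.Strategy .one} {t : G.Strategy .two}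
    (hpos : 0 < O.reachPub s t K) (i : Player) (s' : G.Strategy .one) (t' : G.Strategy .two) :
    O.reachPub s t K * O.subPayoff i K s t s' t' =
      ∑ g ∈ O.entries K, G.reach s t g * G.payoffFrom i s' t' g := by
  unfold subPayoff
  rw [Finset.mul_sum]
  refine Finset.sum_congr rfl fun g _ => ?_
  have := hpos.ne'
  field_simp

/-- Weighting a conditional expectation by the probability of its information set undoes the
conditioning. -/
theorem sum_reach_mul_infoValue {K : κ} {s s' : G.Strategy .one} {t t' : G.Strategy .two}
    {i : Player} {v : μ → ℝ} (hpos : 0 < O.reachPub s t K)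
    (hv : ∀ I, 0 < O.range s t K i I → v I = O.infoValue K s t s' t' i I) :
    ∑ g ∈ O.entries K, G.reach s t g * v (O.aug i g) =
      ∑ g ∈ O.entries K, G.reach s t g * G.payoffFrom i s' t' g := by
  classical
  rw [← Finset.sum_fiberwise_of_maps_to (g := O.aug i) (t := (O.entries K).image (O.aug i))
      (fun h hh => Finset.mem_image_of_mem _ hh),
    ← Finset.sum_fiberwise_of_maps_to (g := O.aug i) (t := (O.entries K).image (O.aug i))
      (fun h hh => Finset.mem_image_of_mem _ hh)]
  refine Finset.sum_congr rfl fun I _ => ?_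
  change ∑ g ∈ O.entriesIn K i I, _ = ∑ g ∈ O.entriesIn K i I, _
  have hnn : ∀ g ∈ O.entriesIn K i I, 0 ≤ G.reach s t g := fun g hg =>
    reach_nonneg s t (entries_subset K (Finset.mem_filter.1 hg).1)
  have hl : ∑ g ∈ O.entriesIn K i I, G.reach s t g * v (O.aug i g) =
      (∑ g ∈ O.entriesIn K i I, G.reach s t g) * v I := by
    rw [Finset.sum_mul]
    refine Finset.sum_congr rfl fun g hg => ?_
    rw [(Finset.mem_filter.1 hg).2]
  rw [hl]
  rcases (Finset.sum_nonneg hnn).eq_or_lt with h0 | h0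
  -- Here `v I` is unconstrained, but every history of the information set has weight zero.
  · rw [← h0, zero_mul]
    refine (Finset.sum_eq_zero fun g hg => ?_).symm
    rw [(Finset.sum_eq_zero_iff_of_nonneg hnn).1 h0.symm g hg, zero_mul]
  · rw [hv I (div_pos h0 hpos), infoValue, mul_div_cancel₀ _ h0.ne']

/-- The values returned by an optimal value function come from a saddle point of the subgame. -/
theorem IsOptimal.exists_saddle (hV : O.IsOptimal V) (hzero : G.ZeroSum) {K : κ}
    (hK : O.IsSubgame (O.below K)) (s : G.Strategy .one) (t : G.Strategy .two) :
    ∃ (s' : G.Strategy .one) (t' : G.Strategy .two),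
      (∀ s'', ∑ g ∈ O.entries K, G.reach s t g * G.payoffFrom .one s'' t' g ≤
        ∑ g ∈ O.entries K, G.reach s t g * V K (O.range s t K) .one (O.aug .one g)) ∧
      (∀ t'', ∑ g ∈ O.entries K, G.reach s t g * V K (O.range s t K) .one (O.aug .one g) ≤
        ∑ g ∈ O.entries K, G.reach s t g * G.payoffFrom .one s' t'' g) := by
  have hnn : ∀ g ∈ O.entries K, 0 ≤ G.reach s t g := fun g hg =>
    reach_nonneg s t (entries_subset K hg)
  rcases (Finset.sum_nonneg hnn).eq_or_lt with h0 | hpos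
  -- Optimality says nothing about an unreached public state; all weighted sums vanish there, so any
  -- pair serves.
  · have hz : ∀ f : List A → ℝ, ∑ g ∈ O.entries K, G.reach s t g * f g = 0 := fun f =>
      Finset.sum_eq_zero fun g hg => by
        rw [(Finset.sum_eq_zero_iff_of_nonneg hnn).1 h0.symm g hg, zero_mul]
    exact ⟨s, t, fun _ => by rw [hz, hz], fun _ => by rw [hz, hz]⟩
  · change 0 < O.reachPub s t K at hpos
    obtain ⟨s', t', ⟨h₁, h₂⟩, hval⟩ := hV K hK s t hpos
    refine ⟨s', t', fun s'' => ?_, fun t'' => ?_⟩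
    · rw [sum_reach_mul_infoValue hpos (hval .one), ← reachPub_mul_subPayoff hpos,
        ← reachPub_mul_subPayoff hpos]
      exact mul_le_mul_of_nonneg_left (h₁ s'') hpos.le
    · rw [sum_reach_mul_infoValue hpos (hval .one)]
      have := mul_le_mul_of_nonneg_left (h₂ t'') hpos.le
      rw [reachPub_mul_subPayoff hpos, reachPub_mul_subPayoff hpos] at this
      simpa [payoffFrom_two hzero] using this

/-- Some continuation of player two below the trunk holds `s` down to its depth-limited utility. -/
theorem IsTrunk.exists_u_le_trunkUtil (hT : O.IsTrunk T) (hS : O.LeavesIntoSubgames T)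
    (hzero : G.ZeroSum) (hV : O.IsOptimal V) (s : G.Strategy .one) (t : G.Strategy .two) :
    ∃ t' : G.Strategy .two, t.AgreeOn T t' ∧ G.u .one s t' ≤ O.trunkUtil V T s t := by
  classical
  -- The subgame condition sits inside the existential so that `choose` gives a strategy for every
  -- `K`, arbitrary where no subgame starts.
  have hex : ∀ K, ∃ t' : G.Strategy .two, O.IsSubgame (O.below K) →
      ∀ s'', ∑ g ∈ O.entries K, G.reach s t g * G.payoffFrom .one s'' t' g ≤
        ∑ g ∈ O.entries K, G.reach s t g * V K (O.range s t K) .one (O.aug .one g) := by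
    intro K
    by_cases hK : O.IsSubgame (O.below K)
    · obtain ⟨s', t', h, -⟩ := hV.exists_saddle hzero hK s t
      exact ⟨t', fun _ => h⟩
    · exact ⟨t, fun h => absurd h hK⟩
  choose τ hτ using hex
  have hag := hT.agreeOn_glue hS t τ
  refine ⟨hT.glue hS t τ, hag, ?_⟩
  rw [hT.u_eq_add, trunkUtil]
  refine add_le_add (Finset.sum_le_sum fun z hz => ?_) ?_
  · rw [hT.reach_congr_mem (.refl T s) hag (Finset.mem_filter.1 hz).2]
  · rw [hT.sum_border hS, hT.sum_border hS]
    refine Finset.sum_le_sum fun K hK => ?_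
    obtain ⟨e, he, rfl⟩ := Finset.mem_image.1 hK
    refine le_trans (le_of_eq ?_) ((hτ (O.pub e) (hS e he) s).trans (le_of_eq ?_))
    · refine Finset.sum_congr rfl fun g hg => ?_
      obtain ⟨hg, hpub⟩ := (hT.mem_entries_iff hS he).1 hg
      rw [hT.reach_congr_border (.refl T s) hag hg, hT.payoffFrom_glue_right hS _ _ _ _ hg, hpub]
    · refine Finset.sum_congr rfl fun g hg => ?_
      rw [((hT.mem_entries_iff hS he).1 hg).2]

/-- Some continuation of player one below the trunk secures the depth-limited utility of `s`. -/
theorem IsTrunk.exists_trunkUtil_le_u (hT : O.IsTrunk T) (hS : O.LeavesIntoSubgames T)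
    (hzero : G.ZeroSum) (hV : O.IsOptimal V) (s : G.Strategy .one) (t : G.Strategy .two) :
    ∃ s' : G.Strategy .one, s.AgreeOn T s' ∧
      ∀ t' : G.Strategy .two, t.AgreeOn T t' → O.trunkUtil V T s t ≤ G.u .one s' t' := by
  classical
  have hex : ∀ K, ∃ s' : G.Strategy .one, O.IsSubgame (O.below K) →
      ∀ t'', ∑ g ∈ O.entries K, G.reach s t g * V K (O.range s t K) .one (O.aug .one g) ≤
        ∑ g ∈ O.entries K, G.reach s t g * G.payoffFrom .one s' t'' g := by
    intro K
    by_cases hK : O.IsSubgame (O.below K)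
    · obtain ⟨s', t', -, h⟩ := hV.exists_saddle hzero hK s t
      exact ⟨s', fun _ => h⟩
    · exact ⟨s, fun h => absurd h hK⟩
  choose τ hτ using hex
  have hag := hT.agreeOn_glue hS s τ
  refine ⟨hT.glue hS s τ, hag, fun t' ht' => ?_⟩
  rw [hT.u_eq_add, trunkUtil]
  refine add_le_add (Finset.sum_le_sum fun z hz => ?_) ?_
  · rw [hT.reach_congr_mem hag ht' (Finset.mem_filter.1 hz).2]
  · rw [hT.sum_border hS, hT.sum_border hS]
    refine Finset.sum_le_sum fun K hK => ?_
    obtain ⟨e, he, rfl⟩ := Finset.mem_image.1 hK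
    refine le_trans (le_of_eq ?_) ((hτ (O.pub e) (hS e he) t').trans (le_of_eq ?_))
    · refine Finset.sum_congr rfl fun g hg => ?_
      rw [((hT.mem_entries_iff hS he).1 hg).2]
    · refine Finset.sum_congr rfl fun g hg => ?_
      obtain ⟨hg, hpub⟩ := (hT.mem_entries_iff hS he).1 hg
      rw [hT.reach_congr_border hag ht' hg, hT.payoffFrom_glue_left hS _ _ _ _ hg, hpub]

/-! ### Ranges and player one's own reach -/

theorem range_congr {K : κ} {s s' : G.Strategy .one} {t : G.Strategy .two}
    (h : ∀ g ∈ O.entries K, G.reach s t g = G.reach s' t g) :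
    O.range s t K = O.range s' t K := by
  classical
  funext i I
  unfold range reachPub
  rw [Finset.sum_congr rfl h,
    Finset.sum_congr rfl fun g (hg : g ∈ O.entriesIn K i I) => h g (Finset.mem_filter.1 hg).1]

/-- Ranges are normalized, so a nonzero factor common to all entries cancels. It will be player
one's own reach, with `c` the part due to chance and player two. -/
theorem range_eq_of_mul {K : κ} {s s' : G.Strategy .one} {t : G.Strategy .two} {p q : ℝ}
    {c : List A → ℝ} (hp : p ≠ 0) (hq : q ≠ 0)
    (hs : ∀ g ∈ O.entries K, G.reach s t g = p * c g)
    (hs' : ∀ g ∈ O.entries K, G.reach s' t g = q * c g) :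
    O.range s t K = O.range s' t K := by
  classical
  funext i I
  unfold range reachPub
  rw [Finset.sum_congr rfl hs, Finset.sum_congr rfl hs',
    Finset.sum_congr rfl fun g (hg : g ∈ O.entriesIn K i I) => hs g (Finset.mem_filter.1 hg).1,
    Finset.sum_congr rfl fun g (hg : g ∈ O.entriesIn K i I) => hs' g (Finset.mem_filter.1 hg).1,
    ← Finset.mul_sum, ← Finset.mul_sum, ← Finset.mul_sum, ← Finset.mul_sum,
    mul_div_mul_left _ _ hp, mul_div_mul_left _ _ hq]

end PublicStates

/-- The contribution of player one to the probability that `w` is played from `g` on. -/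
def ownFrom (s : G.Strategy .one) : List A → List A → ℝ
  | _, [] => 1
  | g, a :: w =>
    if G.turn g = some .one then s.prob g a * ownFrom s (g ++ [a]) w
    else ownFrom s (g ++ [a]) w

/-- The contribution of chance and player two to the probability that `w` is played from `g` on. -/
def othersFrom (t : G.Strategy .two) : List A → List A → ℝ
  | _, [] => 1
  | g, a :: w =>
    (match G.turn g with
      | some .one => 1
      | some .two => t.prob g a
      | none => G.chance g a) * othersFrom t (g ++ [a]) w

theorem reachFrom_eq_own_mul_others (s : G.Strategy .one) (t : G.Strategy .two) :
    ∀ w g : List A, G.reachFrom s t g w = ownFrom s g w * othersFrom t g w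
  | [], _ => by simp [reachFrom, ownFrom, othersFrom]
  | a :: w, g => by
    rw [reachFrom, ownFrom, othersFrom, act, reachFrom_eq_own_mul_others s t w]
    rcases G.turn g with _ | _ | _ <;> simp <;> ring

open Classical in
/-- The probability that `s` assigns to an action, as a function of the information set. -/
noncomputable def Strategy.infoProb (s : G.Strategy .one) (x : ι × A) : ℝ :=
  if hex : ∃ h, G.Acts .one h ∧ G.info .one h = x.1 ∧ x.2 ∈ G.actions h then
    s.prob hex.choose x.2
  else 0

theorem Strategy.infoProb_info (s : G.Strategy .one) {h : List A} {a : A} (hA : G.Acts .one h)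
    (ha : a ∈ G.actions h) : s.infoProb (G.info .one h, a) = s.prob h a := by
  have hex : ∃ g, G.Acts .one g ∧ G.info .one g = (G.info .one h, a).1 ∧
      (G.info .one h, a).2 ∈ G.actions g := ⟨h, hA, rfl, ha⟩
  rw [infoProb, dif_pos hex]
  obtain ⟨h₁, h₂, h₃⟩ := hex.choose_spec
  exact s.same _ _ h₁ hA h₂ a h₃

/-- Own reach depends only on the sequence of own information sets and actions, which is what
perfect recall controls. -/
theorem ownFrom_eq_prod (s : G.Strategy .one) :
    ∀ w g : List A, g ++ w ∈ G.hist →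
      ownFrom s g w = ((G.seqFrom .one g w).map s.infoProb).prod
  | [], _, _ => by simp [ownFrom, seqFrom]
  | a :: w, g, h => by
    have e : g ++ a :: w = (g ++ [a]) ++ w := by simp
    rw [e] at h
    have ha : g ++ [a] ∈ G.hist := G.hist_closed _ h _ (List.prefix_append _ _)
    rw [ownFrom, seqFrom, ownFrom_eq_prod s w _ h]
    split_ifs with hturn
    · rw [List.map_cons, List.prod_cons, s.infoProb_info
        ⟨G.hist_closed _ ha _ (List.prefix_append _ _), ⟨a, ha⟩, hturn⟩ (mem_actions.2 ha)]
    · rfl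

/-! ### Evaluation errors weighted by reach -/

namespace PublicStates

variable {O : G.PublicStates μ κ} {T : Finset (List A)} {V W : O.ValueFunction} {ε : ℝ}

theorem seq_eq_of_aug_eq (hrecall : G.PerfectRecall) (O : G.PublicStates μ κ) {i : Player}
    {h h' : List A} (hh : h ∈ G.hist) (hh' : h' ∈ G.hist) (haug : O.aug i h = O.aug i h') :
    G.seq i h = G.seq i h' := by
  by_cases hA : G.Acts i h
  · obtain ⟨hA', hinfo⟩ := (O.aug_acts i h hA h' hh').1 haug
    exact hrecall i h h' hA hA' hinfo
  · refine O.aug_seq i h hh h' hh' hA (fun hA' => hA ?_) haug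
    exact ((O.aug_acts i h' hA' h hh).1 haug.symm).1

theorem ownFrom_eq_of_aug_eq (hrecall : G.PerfectRecall) (O : G.PublicStates μ κ)
    (s : G.Strategy .one) {h h' : List A} (hh : h ∈ G.hist) (hh' : h' ∈ G.hist)
    (haug : O.aug .one h = O.aug .one h') : ownFrom s [] h = ownFrom s [] h' := by
  have := O.seq_eq_of_aug_eq hrecall hh hh' haug
  unfold seq at this
  rw [ownFrom_eq_prod s h [] hh, ownFrom_eq_prod s h' [] hh', this]

/-- The root is an entry of its public state, so the bound is never vacuous. -/
theorem ErrorAtMost.nonneg (hW : O.ErrorAtMost W V ε) : 0 ≤ ε := by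
  refine (abs_nonneg _).trans (hW (O.pub []) (fun _ _ => 0) .one [] (mem_entries.2 ?_))
  exact ⟨G.root_mem, rfl, fun g hg _ => List.prefix_nil.1 hg⟩

/-- The error of `W` relative to `V` at the history `h`, for the ranges induced by `(s, t)`,
weighted with the probability of reaching `h`. -/
noncomputable def weightedError (O : G.PublicStates μ κ) (W V : O.ValueFunction)
    (s : G.Strategy .one) (t : G.Strategy .two) (h : List A) : ℝ :=
  G.reach s t h * (W (O.pub h) (O.range s t (O.pub h)) .one (O.aug .one h) -
    V (O.pub h) (O.range s t (O.pub h)) .one (O.aug .one h))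

theorem trunkUtil_sub (W V : O.ValueFunction) (T : Finset (List A)) (s : G.Strategy .one)
    (t : G.Strategy .two) :
    O.trunkUtil W T s t - O.trunkUtil V T s t = ∑ h ∈ G.border T, O.weightedError W V s t h := by
  simp only [trunkUtil, weightedError, mul_sub, Finset.sum_sub_distrib]
  ring

theorem abs_sum_weightedError_le (hW : O.ErrorAtMost W V ε) (s : G.Strategy .one)
    (t : G.Strategy .two) {B : Finset (List A)} (hB : ∀ h ∈ B, h ∈ O.entries (O.pub h))
    (anti : ∀ g ∈ B, ∀ h ∈ B, g <+: h → g = h) :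
    |∑ h ∈ B, O.weightedError W V s t h| ≤ ε := by
  have hsub : B ⊆ G.hist := fun h hh => entries_subset _ (hB h hh)
  calc |∑ h ∈ B, O.weightedError W V s t h|
      ≤ ∑ h ∈ B, |O.weightedError W V s t h| := Finset.abs_sum_le_sum_abs _ _
    _ ≤ ∑ h ∈ B, G.reach s t h * ε := by
        refine Finset.sum_le_sum fun h hh => ?_
        rw [weightedError, abs_mul, abs_of_nonneg (reach_nonneg s t (hsub hh))]
        exact mul_le_mul_of_nonneg_left (hW _ _ _ h (hB h hh)) (reach_nonneg s t (hsub hh))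
    _ = (∑ h ∈ B, G.reach s t h) * ε := by rw [Finset.sum_mul]
    _ ≤ ε := mul_le_of_le_one_left hW.nonneg (sum_reach_le_one s t hsub anti)

/-- If a public state is entered in a single information set of player one, changing the strategy
of player one changes only the probability with which it is entered. -/
theorem abs_sum_weightedError_sub_le (hrecall : G.PerfectRecall) (hW : O.ErrorAtMost W V ε)
    (s s' : G.Strategy .one) (t : G.Strategy .two) {K : κ} {I : μ}
    (hI : ∀ h ∈ O.entries K, O.aug .one h = I) :
    |∑ h ∈ O.entries K, O.weightedError W V s t h -
      ∑ h ∈ O.entries K, O.weightedError W V s' t h| ≤ ε := by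
  have hpub : ∀ h ∈ O.entries K, O.pub h = K := fun h hh => (mem_entries.1 hh).2.1
  have hent : ∀ h ∈ O.entries K, h ∈ O.entries (O.pub h) := fun h hh => by rwa [hpub h hh]
  have anti : ∀ g ∈ O.entries K, ∀ h ∈ O.entries K, g <+: h → g = h := fun g hg h hh hp =>
    (mem_entries.1 hh).2.2 g hp (hpub g hg)
  have hsub := entries_subset (O := O) K
  rcases (O.entries K).eq_empty_or_nonempty with h0 | ⟨e, he⟩
  · simpa [h0] using hW.nonneg
  have hfac : ∀ r : G.Strategy .one, ∀ g ∈ O.entries K,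
      G.reach r t g = ownFrom r [] e * othersFrom t [] g := by
    intro r g hg
    rw [reach, reachFrom_eq_own_mul_others, O.ownFrom_eq_of_aug_eq hrecall r (hsub hg) (hsub he)
      ((hI g hg).trans (hI e he).symm)]
  have hzero : ∀ r : G.Strategy .one, ownFrom r [] e = 0 →
      ∑ h ∈ O.entries K, O.weightedError W V r t h = 0 := fun r hr =>
    Finset.sum_eq_zero fun g hg => by rw [weightedError, hfac r g hg, hr, zero_mul, zero_mul]
  -- If one strategy never enters `K`, its error is zero and the range comparison is not needed.
  by_cases hp : ownFrom s [] e = 0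
  · rw [hzero s hp, zero_sub, abs_neg]
    exact abs_sum_weightedError_le hW s' t hent anti
  by_cases hq : ownFrom s' [] e = 0
  · rw [hzero s' hq, sub_zero]
    exact abs_sum_weightedError_le hW s t hent anti
  have hrange := range_eq_of_mul hp hq (hfac s) (hfac s')
  have hsum : ∀ r : G.Strategy .one, O.range r t K = O.range s t K →
      ∑ h ∈ O.entries K, O.weightedError W V r t h =
        (∑ h ∈ O.entries K, G.reach r t h) *
          (W K (O.range s t K) .one I - V K (O.range s t K) .one I) := by
    intro r hr
    rw [Finset.sum_mul]
    refine Finset.sum_congr rfl fun g hg => ?_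
    rw [weightedError, hpub g hg, hI g hg, hr]
  rw [hsum s rfl, hsum s' hrange.symm, ← sub_mul, abs_mul]
  have hle : |W K (O.range s t K) .one I - V K (O.range s t K) .one I| ≤ ε := by
    simpa only [hI e he] using hW K (O.range s t K) .one e he
  -- Both entry probabilities lie in `[0, 1]`, so they differ by at most one.
  refine (mul_le_of_le_one_left (abs_nonneg _) ?_).trans hle
  have h₁ := sum_reach_le_one s t hsub anti
  have h₂ := sum_reach_le_one s' t hsub anti
  have h₃ := Finset.sum_nonneg fun g hg => reach_nonneg s t (hsub hg)
  have h₄ := Finset.sum_nonneg fun g hg => reach_nonneg s' t (hsub hg)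
  rw [abs_le]
  constructor <;> linarith

/-! ### Borders of the pieces and the induction over trunks -/

namespace SubgamePartitioning

variable (P : O.SubgamePartitioning)

theorem prev_subset (k : ℕ) : P.prev k ⊆ P.trunk k := by
  cases k with
  | zero => exact Finset.empty_subset _
  | succ k => exact P.mono k.le_succ

theorem border_piece_subset (k : ℕ) : G.border (P.piece k) ⊆ G.border (P.trunk k) := by
  classical
  intro h hh
  obtain ⟨hh, hn, g, hg, a, rfl⟩ := mem_border.1 hh
  obtain ⟨hg, hgp⟩ := Finset.mem_sdiff.1 hg
  refine mem_border.2 ⟨hh, fun hm => ?_, g, hg, a, rfl⟩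
  have hp : g ++ [a] ∈ P.prev k := by
    by_contra hp
    exact hn (Finset.mem_sdiff.2 ⟨hm, hp⟩)
  cases k with
  | zero => simp [prev] at hp
  | succ k => exact hgp ((P.isTrunk k).down _ hp g (List.prefix_append _ _))

theorem mem_border_prev {k : ℕ} {h : List A} (hh : h ∈ G.border (P.trunk k))
    (hn : h ∉ G.border (P.piece k)) : h ∈ G.border (P.prev k) := by
  classical
  obtain ⟨hh, hT, g, hg, a, rfl⟩ := mem_border.1 hh
  refine mem_border.2 ⟨hh, fun hm => hT (P.prev_subset k hm), g, ?_, a, rfl⟩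
  by_contra hp
  exact hn (mem_border.2 ⟨hh, fun hm => hT (Finset.mem_sdiff.1 hm).1, g,
    Finset.mem_sdiff.2 ⟨hg, hp⟩, a, rfl⟩)

theorem notMem_border_prev {k : ℕ} {h : List A} (hh : h ∈ G.border (P.piece k)) :
    h ∉ G.border (P.prev k) := by
  classical
  intro hp
  obtain ⟨-, -, g, hg, a, rfl⟩ := mem_border.1 hh
  obtain ⟨-, -, g', hg', a', e⟩ := mem_border.1 hp
  rw [(List.append_inj' e rfl).1] at hg
  exact (Finset.mem_sdiff.1 hg).2 hg'

theorem weightedError_congr {k : ℕ} {s s' : G.Strategy .one} {t : G.Strategy .two}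
    (hag : s.AgreeOn (P.prev k) s') {h : List A} (hh : h ∈ G.border (P.prev k)) :
    O.weightedError W V s t h = O.weightedError W V s' t h := by
  cases k with
  | zero => simp [prev, border] at hh
  | succ k =>
    have hreach : ∀ g ∈ G.border (P.trunk k), G.reach s t g = G.reach s' t g := fun g hg =>
      (P.isTrunk k).reach_congr_border hag (.refl _ t) hg
    unfold weightedError
    rw [hreach h hh, range_congr fun g hg =>
      hreach g (((P.isTrunk k).mem_entries_iff (P.isSubgame k) hh).1 hg).1]

/-- Old and new borders share no public state: an entry on the old border would make all entries of
that public state, including `e`, lie on the old border. -/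
theorem entries_subset_border_piece {k : ℕ} {e : List A} (he : e ∈ G.border (P.piece k)) :
    O.entries (O.pub e) ⊆ G.border (P.piece k) := by
  intro g hg
  have he' := P.border_piece_subset k he
  obtain ⟨hg', hpub⟩ := ((P.isTrunk k).mem_entries_iff (P.isSubgame k) he').1 hg
  by_contra hn
  have hp := P.mem_border_prev hg' hn
  apply P.notMem_border_prev he
  cases k with
  | zero => simp [prev, border] at hp
  | succ k =>
    refine (((P.isTrunk k).mem_entries_iff (P.isSubgame k) hp).1 ?_).1
    rw [hpub]
    exact ((P.isTrunk (k + 1)).mem_entries_iff (P.isSubgame (k + 1)) he').2 ⟨he', rfl⟩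

theorem abs_sum_border_piece_sub_le (hrecall : G.PerfectRecall) (hW : O.ErrorAtMost W V ε)
    (k : ℕ) (s s' : G.Strategy .one) (t : G.Strategy .two) :
    |∑ h ∈ G.border (P.piece k), O.weightedError W V s t h -
      ∑ h ∈ G.border (P.piece k), O.weightedError W V s' t h| ≤
        ((P.borderInfosets k).card : ℝ) * ε := by
  classical
  have hT := P.isTrunk k
  have hS : O.LeavesIntoSubgames (P.trunk k) := P.isSubgame k
  have hε := hW.nonneg
  have hent : ∀ h ∈ G.border (P.piece k), h ∈ O.entries (O.pub h) := fun h hh =>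
    have hh' := P.border_piece_subset k hh
    (hT.mem_entries_iff hS hh').2 ⟨hh', rfl⟩
  have anti : ∀ g ∈ G.border (P.piece k), ∀ h ∈ G.border (P.piece k), g <+: h → g = h :=
    fun g hg h hh => hT.border_antichain g (P.border_piece_subset k hg) h
      (P.border_piece_subset k hh)
  rcases (G.border (P.piece k)).eq_empty_or_nonempty with h0 | ⟨e, he⟩
  · simp only [h0, Finset.sum_empty, sub_zero, abs_zero]
    positivity
  have heI : O.aug .one e ∈ P.borderInfosets k := Finset.mem_image_of_mem _ he
  -- One information set must be handled with error `ε`; from two on, the triangle inequality with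
  -- `2 * ε` is enough.
  by_cases hcard : (P.borderInfosets k).card ≤ 1
  · have hI : ∀ h ∈ G.border (P.piece k), O.aug .one h = O.aug .one e := fun h hh =>
      Finset.card_le_one.1 hcard _ (Finset.mem_image_of_mem _ hh) _ heI
    have hsub := P.entries_subset_border_piece he
    -- A single information set lies in a single public state, so the new border is exactly its
    -- entry set.
    have hBe : G.border (P.piece k) = O.entries (O.pub e) := by
      refine Finset.Subset.antisymm (fun h hh => ?_) hsub
      rw [← O.pub_closed .one h (mem_border.1 hh).1 e (mem_border.1 he).1 (hI h hh)]
      exact hent h hh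
    rw [hBe]
    refine (abs_sum_weightedError_sub_le hrecall hW s s' t fun h hh => hI h (hsub hh)).trans ?_
    have : (1 : ℝ) ≤ (P.borderInfosets k).card := by
      exact_mod_cast Finset.card_pos.2 ⟨_, heI⟩
    nlinarith
  · have h₁ := abs_sum_weightedError_le hW s t hent anti
    have h₂ := abs_sum_weightedError_le hW s' t hent anti
    have : (2 : ℝ) ≤ (P.borderInfosets k).card := by
      exact_mod_cast Nat.succ_le_of_lt (not_le.1 hcard)
    refine (abs_sub _ _).trans ?_
    nlinarith

/-- Terminal payoffs drop out of each difference, and the errors on the part of the border inherited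
from the previous trunk agree for `s` and `s'`. -/
theorem abs_trunkUtil_sub_le (hrecall : G.PerfectRecall) (hW : O.ErrorAtMost W V ε)
    {k : ℕ} {s s' : G.Strategy .one} (t : G.Strategy .two) (hag : s.AgreeOn (P.prev k) s') :
    |(O.trunkUtil W (P.trunk k) s t - O.trunkUtil V (P.trunk k) s t) -
      (O.trunkUtil W (P.trunk k) s' t - O.trunkUtil V (P.trunk k) s' t)| ≤
        ((P.borderInfosets k).card : ℝ) * ε := by
  classical
  rw [trunkUtil_sub, trunkUtil_sub, ← Finset.sum_sdiff (P.border_piece_subset k),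
    ← Finset.sum_sdiff (P.border_piece_subset k),
    Finset.sum_congr rfl fun h hh => P.weightedError_congr hag
      (P.mem_border_prev (Finset.mem_sdiff.1 hh).1 (Finset.mem_sdiff.1 hh).2),
    add_sub_add_left_eq_sub]
  exact P.abs_sum_border_piece_sub_le hrecall hW k s s' t

theorem borderInfosets_last : P.borderInfosets P.n = ∅ := by
  have h := P.border_piece_subset P.n
  rw [P.last, border_hist, Finset.subset_empty] at h
  simp [borderInfosets, h]

theorem trunkUtil_last (V : O.ValueFunction) (s : G.Strategy .one) (t : G.Strategy .two) :
    O.trunkUtil V (P.trunk P.n) s t = G.u .one s t := by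
  rw [(P.isTrunk P.n).u_eq_add, trunkUtil, P.last, border_hist, Finset.sum_empty,
    Finset.sum_empty]

variable {P} in
/-- One step of a continual depth-limited best response, measured with the optimal values. -/
theorem IsCDBR.trunkUtil_le {σ : G.Strategy .one} {t : G.Strategy .two} {εR : ℝ}
    (hσ : P.IsCDBR t W εR σ) (hrecall : G.PerfectRecall) (hW : O.ErrorAtMost W V ε) {k : ℕ}
    (hk : k ≤ P.n) {s : G.Strategy .one} (hag : s.AgreeOn (P.prev k) σ) :
    O.trunkUtil V (P.trunk k) s t ≤ O.trunkUtil V (P.trunk k) σ t + εR +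
      ((P.borderInfosets k).card : ℝ) * ε := by
  have h₁ := hσ k hk s hag
  have h₂ := (abs_le.1 (P.abs_trunkUtil_sub_le hrecall hW t hag)).1
  linarith

variable {P} in
theorem IsCDBR.u_le_trunkUtil {σ : G.Strategy .one} {σF : G.Strategy .two} {εR : ℝ}
    (hσ : P.IsCDBR σF W εR σ) (hzero : G.ZeroSum) (hrecall : G.PerfectRecall)
    (hV : O.IsOptimal V) (hW : O.ErrorAtMost W V ε) {s : G.Strategy .one} {t : G.Strategy .two}
    (hNE : G.IsNash s t) :
    ∀ k ≤ P.n, G.u .one s t ≤ O.trunkUtil V (P.trunk k) σ σF + ((k : ℝ) + 1) * εR +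
      ∑ j ∈ Finset.range (k + 1), ((P.borderInfosets j).card : ℝ) * ε := by
  intro k
  induction k with
  | zero =>
    intro hk
    -- Player two's deviation `t'` need not help him against the equilibrium strategy `s`, which
    -- bounds the equilibrium payoff by the trunk value of `s`.
    obtain ⟨t', -, ht'⟩ := (P.isTrunk 0).exists_u_le_trunkUtil (P.isSubgame 0) hzero hV s σF
    have h₁ := hNE.2 t'
    rw [u_two hzero, u_two hzero] at h₁
    have h₂ := hσ.trunkUtil_le hrecall hW hk (s := s) (fun h hh => by simp [prev] at hh)
    simp only [Nat.cast_zero, zero_add, one_mul, Finset.sum_range_one]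
    linarith
  | succ k ih =>
    intro hk
    have h₀ := ih (Nat.le_of_succ_le hk)
    -- The true payoff of `s'` against `t'` links the two trunks: `s'` secures the value of trunk
    -- `k`, while `t'` holds it to its value in trunk `k + 1`. Agreement of `t'` with `σF` on the
    -- larger trunk gives agreement on the smaller.
    obtain ⟨s', hs', hle⟩ :=
      (P.isTrunk k).exists_trunkUtil_le_u (P.isSubgame k) hzero hV σ σF
    obtain ⟨t', ht', hle'⟩ :=
      (P.isTrunk (k + 1)).exists_u_le_trunkUtil (P.isSubgame (k + 1)) hzero hV s' σF
    have h₁ := hle t' fun h hh => ht' h (P.mono k.le_succ hh)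
    have h₂ := hσ.trunkUtil_le hrecall hW hk (s := s')
      (fun h hh hA a ha => (hs' h hh hA a ha).symm)
    rw [Finset.sum_range_succ]
    push_cast
    linarith

end SubgamePartitioning

end PublicStates

end EFG

theorem theorem2 {A ι μ κ : Type*} [Fintype A] (G : EFG A ι)
    (hzero : G.ZeroSum) (hrecall : G.PerfectRecall)
    (O : G.PublicStates μ κ) (P : O.SubgamePartitioning)
    (σF : G.Strategy .two) (V W : O.ValueFunction) (εV εR : ℝ)
    (hV : O.IsOptimal V) (hW : O.ErrorAtMost W V εV)
    (σ : G.Strategy .one) (hσ : P.IsCDBR σF W εR σ)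
    (s : G.Strategy .one) (t : G.Strategy .two) (hNE : G.IsNash s t) :
    G.u .one s t ≤ G.u .one σ σF + ((P.n : ℝ) + 1) * εR +
      ∑ k ∈ Finset.range P.n, ((P.borderInfosets k).card : ℝ) * εV := by
  have h := hσ.u_le_trunkUtil hzero hrecall hV hW hNE P.n le_rfl
  rwa [P.trunkUtil_last, Finset.sum_range_succ, P.borderInfosets_last, Finset.card_empty,
    Nat.cast_zero, zero_mul, add_zero] at h
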